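/- Let $\mathcal S$ be a measurable space (states) and $\mathcal A$ a nonempty standard Borel space (actions). Let $\mathcal T$ be a probability distribution over tasks $\mathcal M=(\mathcal S,\mathcal A,\mathcal P,\mathcal R_{\mathcal M},\gamma)$ that share the initial state distribution, the transition kernel $\mathcal P(\cdot\mid s,a)$ and the discount factor $\gamma\in(0,1)$ and differ only in the reward function $\mathcal R_{\mathcal M}:\mathcal S\times\mathcal A\to\mathbb R$. Assume that $\mathcal R_{\mathcal M}(s,a)$ is jointly measurable in $(\mathcal M,s,a)$ and that $|\mathcal R_{\mathcal M}(s,a)|\le C(\mathcal M)$ for all $\mathcal M,s,a$, for some $C$ with $\mathbb E_{\mathcal M\sim\mathcal T}[C(\mathcal M)]<\infty$. A policy $\pi$ chooses, measurably, at each time $t$ a distribution of the action $a_t$ from the history $(s_0,a_0,r_0,\dots,s_{t-1},a_{t-1},r_{t-1},s_t)$, where $s_{t+1}\sim\mathcal P(\cdot\mid s_t,a_t)$ and $r_t=\mathcal R_{\mathcal M}(s_t,a_t)$; let $J_{\mathcal M}(\pi)=\mathbb E\big[\sum_{t=0}^\infty\gamma^t r_t\big]$. Let $\Pi_1$ be the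 set of Markovian policies, $\pi:\mathcal S\to\Delta(\mathcal A)$ (stationary, depending on $s_t$ only), and $\Pi_2$ the set of policies that depend on $(s_0,a_0,\dots,s_{t-1},a_{t-1},s_t)$ but not on the rewards. Put $$J^i_{\mathcal T}=\sup_{\pi\in\Pi_i}\mathbb E_{\mathcal M\sim\mathcal T}[J_{\mathcal M}(\pi)]\quad(i=1,2),\qquad J^*_{\mathcal T}=\mathbb E_{\mathcal M\sim\mathcal T}\Big[\sup_{\pi}J_{\mathcal M}(\pi)\Big],$$ where the last supremum is over all policies (and the last expectation is read as a lower integral, which is the ordinary expectation whenever $\mathcal M\mapsto\sup_\pi J_{\mathcal M}(\pi)$ is measurable). Let $\bar{\mathcal M}=(\mathcal S,\mathcal A,\mathcal P,\bar{\mathcal R},\gamma)$, with the same initial distribution and $\bar{\mathcal R}(s,a)=\mathbb E_{\mathcal M\sim\mathcal T}[\mathcal R_{\mathcal M}(s,a)]$. Then for every $\pi\in\Pi_2$ the function $\mathcal M\mapsto J_{\mathcal M}(\pi)$ is integrable and $$\mathbb E_{\mathcal M\sim\mathcal T}[J_{\mathcal M}(\pi)]=J_{\bar{\mathcal M}}(\pi).$$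 Moreover $$J^1_{\mathcal T}=J^2_{\mathcal T}\le J^*_{\mathcal T},$$ and the supremum defining $J^1_{\mathcal T}$ is attained if and only if the one defining $J^2_{\mathcal T}$ is; in that case the two maxima are equal. -/

import Mathlib

open MeasureTheory ProbabilityTheory

/-- A discounted Markov decision process on the measurable spaces `S` (states) and `A` (actions):
initial state law, transition kernel, reward function of the current state and action, and a
discount factor in `(0, 1)`. -/
structure MDP (S A : Type*) [MeasurableSpace S] [MeasurableSpace A] where
  init : Measure S
  init_prob : IsProbabilityMeasure init
  trans : Kernel (S × A) S
  trans_markov : IsMarkovKernel trans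
  reward : S × A → ℝ
  reward_measurable : Measurable reward
  discount : ℝ
  discount_pos : 0 < discount
  discount_lt_one : discount < 1

/-- One time step `(s, a, r)` of a trajectory: state, action, reward. -/
abbrev Step (S A : Type*) := S × A × ℝ

/-- A general (randomized) policy: at each time `t` it chooses the law of the action from the past
states, actions and rewards `(s₀, a₀, r₀, …, s_{t-1}, a_{t-1}, r_{t-1})` and the current state.
The type of all policies is the policy class `Π₃`. -/
structure Policy (S A : Type*) [MeasurableSpace S] [MeasurableSpace A] where
  kernel : (t : ℕ) → Kernel ((Fin t → Step S A) × S) A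
  markov : ∀ t, IsMarkovKernel (kernel t)

attribute [instance] MDP.init_prob MDP.trans_markov Policy.markov

noncomputable section

/-- Forget the past rewards in a history. -/
def forgetRewards (S A : Type*) (t : ℕ) (h : (Fin t → Step S A) × S) : (Fin t → S × A) × S :=
  (fun i => ((h.1 i).1, (h.1 i).2.1), h.2)

theorem measurable_forgetRewards (S A : Type*) [MeasurableSpace S] [MeasurableSpace A] (t : ℕ) :
    Measurable (forgetRewards S A t) := by
  unfold forgetRewards
  fun_prop

/-- `Π₁`: Markovian policies; one kernel from the current state to actions, used at all times. -/
def markovPolicies (S A : Type*) [MeasurableSpace S] [MeasurableSpace A] : Set (Policy S A) :=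
  {π | ∃ κ : Kernel S A, IsMarkovKernel κ ∧
    ∀ t, π.kernel t = κ.comap Prod.snd measurable_snd}

/-- `Π₂`: policies that depend on past states and actions and the current state, but not on past
rewards. -/
def stateActionPolicies (S A : Type*) [MeasurableSpace S] [MeasurableSpace A] :
    Set (Policy S A) :=
  {π | ∃ κ : (t : ℕ) → Kernel ((Fin t → S × A) × S) A, (∀ t, IsMarkovKernel (κ t)) ∧
    ∀ t, π.kernel t = (κ t).comap (forgetRewards S A t) (measurable_forgetRewards S A t)}

namespace MDP

variable {S A : Type*} [MeasurableSpace S] [MeasurableSpace A]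

/-- Given the past and the current state `s`, draw the action `a` from the policy, receive the
reward `R(s, a)`, and record `(s, a, R(s, a))`. -/
def actKernel (M : MDP S A) (π : Policy S A) (t : ℕ) :
    Kernel ((Fin t → Step S A) × S) (Step S A) :=
  (Kernel.id ×ₖ π.kernel t).map
    (fun p : ((Fin t → Step S A) × S) × A => (p.1.2, p.2, M.reward (p.1.2, p.2)))

instance (M : MDP S A) (π : Policy S A) (t : ℕ) : IsMarkovKernel (M.actKernel π t) := by
  have := M.reward_measurable
  exact Kernel.IsMarkovKernel.map _ (by fun_prop)

/-- The law of the step at time `0`: the state is drawn from the initial law. -/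
def firstStep (M : MDP S A) (π : Policy S A) : Measure (Step S A) :=
  (M.init.map (fun s => ((fun i => i.elim0 : Fin 0 → Step S A), s))).bind (M.actKernel π 0)

instance (M : MDP S A) (π : Policy S A) : IsProbabilityMeasure (M.firstStep π) := by
  have : IsProbabilityMeasure
      (M.init.map (fun s => ((fun i => i.elim0 : Fin 0 → Step S A), s))) :=
    Measure.isProbabilityMeasure_map (by fun_prop)
  unfold firstStep
  infer_instance

/-- The steps at times `0, …, n` as a family indexed by `Fin (n + 1)`. -/
def pastSteps (n : ℕ) (h : (i : Finset.Iic n) → Step S A) : Fin (n + 1) → Step S A :=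
  fun i => h ⟨i, Finset.mem_Iic.2 (Nat.lt_succ_iff.1 i.isLt)⟩

/-- The state and the action at time `n`. -/
def lastPair (n : ℕ) (h : (i : Finset.Iic n) → Step S A) : S × A :=
  ((h ⟨n, Finset.mem_Iic.2 le_rfl⟩).1, (h ⟨n, Finset.mem_Iic.2 le_rfl⟩).2.1)

theorem measurable_pastSteps (n : ℕ) : Measurable (pastSteps (S := S) (A := A) n) := by
  unfold pastSteps
  fun_prop

theorem measurable_lastPair (n : ℕ) : Measurable (lastPair (S := S) (A := A) n) := by
  unfold lastPair
  fun_prop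

/-- The law of the step at time `n + 1` given the steps at times `0, …, n`: the next state is drawn
from the transition kernel, then the policy acts. -/
def nextStep (M : MDP S A) (π : Policy S A) (n : ℕ) :
    Kernel ((i : Finset.Iic n) → Step S A) (Step S A) :=
  M.actKernel π (n + 1) ∘ₖ
    (Kernel.deterministic (pastSteps n) (measurable_pastSteps n) ×ₖ
      M.trans.comap (lastPair n) (measurable_lastPair n))

instance (M : MDP S A) (π : Policy S A) (n : ℕ) : IsMarkovKernel (M.nextStep π n) := by
  unfold nextStep
  infer_instance

/-- The law of the infinite trajectory `(s₀, a₀, r₀, s₁, a₁, r₁, …)` generated by `π` in `M`. -/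
def trajLaw (M : MDP S A) (π : Policy S A) : Measure (ℕ → Step S A) :=
  Kernel.trajMeasure (X := fun _ => Step S A) (M.firstStep π) (M.nextStep π)

/-- The expected discounted return `J_M(π)`. -/
def value (M : MDP S A) (π : Policy S A) : ℝ :=
  ∫ τ, ∑' t, M.discount ^ t * (τ t).2.2 ∂(M.trajLaw π)

/-- The optimal return `sup_π J_M(π)` over all policies. -/
def optValue (M : MDP S A) : ℝ := ⨆ π : Policy S A, M.value π

end MDP

/-- The lower integral of a real function: the supremum of the integrals of its integrable
minorants. It is the integral whenever the function is integrable, see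
`lowerExpectation_eq_integral`, and it is meaningful for suprema over uncountable families, which
need not be measurable. -/
def lowerExpectation {Θ : Type*} [MeasurableSpace Θ] (μ : Measure Θ) (f : Θ → ℝ) : ℝ :=
  sSup {c | ∃ g : Θ → ℝ, Integrable g μ ∧ (∀ θ, g θ ≤ f θ) ∧ c = ∫ θ, g θ ∂μ}

theorem lowerExpectation_eq_integral {Θ : Type*} [MeasurableSpace Θ] (μ : Measure Θ) (f : Θ → ℝ)
    (hf : Integrable f μ) : lowerExpectation μ f = ∫ θ, f θ ∂μ := by
  refine IsGreatest.csSup_eq ⟨⟨f, hf, fun _ => le_rfl, rfl⟩, ?_⟩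
  rintro c ⟨g, hg, hle, rfl⟩
  exact integral_mono hg hf hle

/-- A distribution of tasks `θ ∈ Θ`: MDPs with the same states, actions, initial law, dynamics and
discount factor, and with a reward function that depends on the task. -/
structure TaskDistribution (S A Θ : Type*) [MeasurableSpace S] [MeasurableSpace A]
    [MeasurableSpace Θ] where
  law : Measure Θ
  law_prob : IsProbabilityMeasure law
  init : Measure S
  init_prob : IsProbabilityMeasure init
  trans : Kernel (S × A) S
  trans_markov : IsMarkovKernel trans
  reward : Θ → S × A → ℝ
  reward_measurable : Measurable (Function.uncurry reward)
  discount : ℝ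
  discount_pos : 0 < discount
  discount_lt_one : discount < 1

attribute [instance] TaskDistribution.law_prob

namespace TaskDistribution

variable {S A Θ : Type*} [MeasurableSpace S] [MeasurableSpace A] [MeasurableSpace Θ]

/-- The MDP of the task `θ`. -/
def task (D : TaskDistribution S A Θ) (θ : Θ) : MDP S A where
  init := D.init
  init_prob := D.init_prob
  trans := D.trans
  trans_markov := D.trans_markov
  reward := D.reward θ
  reward_measurable := D.reward_measurable.comp measurable_prodMk_left
  discount := D.discount
  discount_pos := D.discount_pos
  discount_lt_one := D.discount_lt_one

/-- The average MDP, whose reward function is the mean of the reward functions of the tasks. -/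
def average (D : TaskDistribution S A Θ) : MDP S A where
  init := D.init
  init_prob := D.init_prob
  trans := D.trans
  trans_markov := D.trans_markov
  reward := fun x => ∫ θ, D.reward θ x ∂D.law
  reward_measurable :=
    (D.reward_measurable.stronglyMeasurable.integral_prod_left'
      (μ := D.law)).measurable
  discount := D.discount
  discount_pos := D.discount_pos
  discount_lt_one := D.discount_lt_one

/-- The expected return of `π` averaged over the tasks. -/
def meanValue (D : TaskDistribution S A Θ) (π : Policy S A) : ℝ :=
  ∫ θ, (D.task θ).value π ∂D.law

/-- The best mean return `sup_{π ∈ Π} E_θ[J_θ(π)]` over a policy class `Π`. -/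
def bestValue (D : TaskDistribution S A Θ) (P : Set (Policy S A)) : ℝ :=
  sSup (D.meanValue '' P)

/-- `J* = E_θ[sup_π J_θ(π)]`, the supremum being over all policies. -/
def optimalReturn (D : TaskDistribution S A Θ) : ℝ :=
  lowerExpectation D.law (fun θ => (D.task θ).optValue)

end TaskDistribution

end

/-!
The return of a policy `π` is the integral of the reward against its discounted occupation measure
`ν = ∑ₜ γᵗ law(sₜ, aₜ)`. If `π` does not observe rewards, then `ν` is the same in all tasks, and
Fubini turns the mean return into the return in the average MDP. The state marginal `β` of `ν`
satisfies the flow equation `β = μ₀ + γ K β`, where `μ₀` is the initial law and `K` the transition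
kernel of the state under the action kernel obtained by disintegrating `ν`. This kernel defines a
Markovian policy whose state marginal satisfies the same equation; its finite solution being unique
(`γ < 1`), the two occupation measures agree. So both policy classes have the same set of mean
returns. The bound by `J*` is pointwise domination `J_θ(π) ≤ sup_π J_θ(π)`.
-/

open scoped ENNReal

section Resolvent

variable {α β : Type*} [MeasurableSpace α] [MeasurableSpace β]

theorem kernel_comp_measure_mono (κ : Kernel α β) {μ ν : Measure α} (h : μ ≤ ν) :
    κ ∘ₘ μ ≤ κ ∘ₘ ν := by
  refine Measure.le_iff.2 fun s hs => ?_
  rw [Measure.bind_apply hs κ.aemeasurable, Measure.bind_apply hs κ.aemeasurable]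
  exact lintegral_mono' h le_rfl

variable {κ : Kernel α α} [IsMarkovKernel κ] {c : ℝ≥0∞} {μ ν ρ : Measure α}

theorem eq_of_le_of_add_smul_comp_le [IsFiniteMeasure ρ] (hc : c < 1)
    (hρ : ρ = μ + c • (κ ∘ₘ ρ)) (hν : μ + c • (κ ∘ₘ ν) ≤ ν) (hle : ν ≤ ρ) : ν = ρ := by
  have : IsFiniteMeasure ν := isFiniteMeasure_of_le ρ hle
  have : IsFiniteMeasure μ := isFiniteMeasure_of_le ρ (hρ ▸ Measure.le_add_right le_rfl)
  have hmass_ρ := congrArg (fun m : Measure α => m Set.univ) hρ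
  have hmass_ν := hν Set.univ
  simp only [Measure.add_apply, Measure.smul_apply, Measure.comp_apply_univ, smul_eq_mul]
    at hmass_ρ hmass_ν
  refine Measure.eq_of_le_of_measure_univ_eq hle ((hle _).antisymm ?_)
  lift c to NNReal using hc.ne_top
  lift μ Set.univ to NNReal using measure_ne_top μ _ with m
  lift ν Set.univ to NNReal using measure_ne_top ν _ with n
  lift ρ Set.univ to NNReal using measure_ne_top ρ _ with r
  norm_cast at *
  rw [← NNReal.coe_lt_coe, NNReal.coe_one] at hc
  rw [← NNReal.coe_inj] at hmass_ρ
  rw [← NNReal.coe_le_coe] at hmass_ν ⊢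
  push_cast at *
  nlinarith

/-- The infimum of two solutions is a supersolution below both, so mass comparison makes it equal
to each of them. -/
theorem eq_of_eq_add_smul_comp [IsFiniteMeasure ν] [IsFiniteMeasure ρ] (hc : c < 1)
    (hν : ν = μ + c • (κ ∘ₘ ν)) (hρ : ρ = μ + c • (κ ∘ₘ ρ)) : ν = ρ := by
  have hsuper : μ + c • (κ ∘ₘ (ν ⊓ ρ)) ≤ ν ⊓ ρ := by
    refine le_inf ?_ ?_
    · conv_rhs => rw [hν]
      gcongr
      exact kernel_comp_measure_mono κ inf_le_left
    · conv_rhs => rw [hρ]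
      gcongr
      exact kernel_comp_measure_mono κ inf_le_right
  exact (eq_of_le_of_add_smul_comp_le hc hν hsuper inf_le_left).symm.trans
    (eq_of_le_of_add_smul_comp_le hc hρ hsuper inf_le_right)

end Resolvent

section Trajectory

open Preorder

theorem map_left_compProd {α β γ : Type*} [MeasurableSpace α] [MeasurableSpace β]
    [MeasurableSpace γ] {μ : Measure α} [SFinite μ] {f : α → β} (hf : Measurable f)
    (η : Kernel β γ) [IsSFiniteKernel η] :
    μ.map f ⊗ₘ η = (μ ⊗ₘ η.comap f hf).map (Prod.map f id) := by
  ext s hs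
  rw [Measure.map_apply (by fun_prop) hs, Measure.compProd_apply hs,
    Measure.compProd_apply (hs.preimage (by fun_prop)),
    lintegral_map (Kernel.measurable_kernel_prodMk_left hs) hf]
  rfl

variable {X Y : ℕ → Type*} [∀ n, MeasurableSpace (X n)] [∀ n, MeasurableSpace (Y n)]

theorem ext_of_map_frestrictLe {P Q : Measure (Π n, X n)} [IsFiniteMeasure P]
    (h : ∀ n, P.map (frestrictLe n) = Q.map (frestrictLe n)) : P = Q := by
  have hfam : IsProjectiveMeasureFamily fun I : Finset ℕ => P.map I.restrict := fun I J hJI => by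
    rw [Measure.map_map (by fun_prop) (by fun_prop)]
    rfl
  have hP : IsProjectiveLimit P fun I : Finset ℕ => P.map I.restrict := fun _ => rfl
  exact hP.unique ((isProjectiveLimit_nat_iff hfam Q).2 fun n => (h n).symm)

theorem map_frestrictLe_zero (P : Measure (Π n, X n)) : P.map (frestrictLe 0) =
    (P.map fun x => x 0).map (MeasurableEquiv.piUnique fun i : Finset.Iic 0 => X i).symm := by
  refine Eq.trans ?_ (Measure.map_map (MeasurableEquiv.measurable _) (measurable_pi_apply 0)).symm
  congr with x i
  rw [Subsingleton.elim i default]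
  rfl

theorem map_frestrictLe_succ (P : Measure (Π n, X n)) (n : ℕ) : P.map (frestrictLe (n + 1)) =
    (P.map fun x => (frestrictLe n x, x (n + 1))).map
      (IicProdIoc n (n + 1) ∘ Prod.map id (MeasurableEquiv.piSingleton n)) := by
  rw [Measure.map_map (by fun_prop) (by fun_prop)]
  congr with x i
  obtain ⟨i, hi⟩ := i
  rcases Nat.le_or_eq_of_le_succ (Finset.mem_Iic.1 hi) with h | rfl
  · simp [IicProdIoc, h]
  · simp [IicProdIoc, MeasurableEquiv.piSingleton]

theorem map_eval_zero_trajMeasure (μ₀ : Measure (X 0))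
    (κ : (n : ℕ) → Kernel (Π i : Finset.Iic n, X i) (X (n + 1))) [∀ n, IsMarkovKernel (κ n)] :
    (Kernel.trajMeasure μ₀ κ).map (fun x => x 0) = μ₀ := by
  refine MeasurableEquiv.map_measurableEquiv_injective
    (MeasurableEquiv.piUnique fun i : Finset.Iic 0 => X i).symm ?_
  refine (map_frestrictLe_zero _).symm.trans ?_
  rw [Kernel.trajMeasure, Measure.map_comp _ _ (by fun_prop), Kernel.traj_map_frestrictLe,
    Kernel.partialTraj_self, Measure.id_comp]
  rfl

theorem map_eval_succ_trajMeasure (μ₀ : Measure (X 0)) [IsProbabilityMeasure μ₀]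
    (κ : (n : ℕ) → Kernel (Π i : Finset.Iic n, X i) (X (n + 1))) [∀ n, IsMarkovKernel (κ n)]
    (n : ℕ) : (Kernel.trajMeasure μ₀ κ).map (fun x => x (n + 1)) =
      κ n ∘ₘ (Kernel.trajMeasure μ₀ κ).map (frestrictLe n) := by
  have : IsProbabilityMeasure ((Kernel.trajMeasure μ₀ κ).map (frestrictLe n)) :=
    Measure.isProbabilityMeasure_map (by fun_prop)
  rw [← Measure.snd_compProd, Kernel.map_frestrictLe_trajMeasure_compProd_eq_map_trajMeasure,
    Measure.snd, Measure.map_map (by fun_prop) (by fun_prop)]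
  rfl

theorem eq_trajMeasure {μ₀ : Measure (X 0)} [IsProbabilityMeasure μ₀]
    {κ : (n : ℕ) → Kernel (Π i : Finset.Iic n, X i) (X (n + 1))} [∀ n, IsMarkovKernel (κ n)]
    {P : Measure (Π n, X n)} (h_zero : P.map (fun x => x 0) = μ₀)
    (h_succ : ∀ n, P.map (frestrictLe n) ⊗ₘ κ n = P.map fun x => (frestrictLe n x, x (n + 1))) :
    P = Kernel.trajMeasure μ₀ κ := by
  refine (ext_of_map_frestrictLe fun n => ?_).symm
  induction n with
  | zero =>
    rw [map_frestrictLe_zero, map_frestrictLe_zero]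
    exact congrArg (Measure.map _) ((map_eval_zero_trajMeasure μ₀ κ).trans h_zero.symm)
  | succ n ih =>
    rw [map_frestrictLe_succ, map_frestrictLe_succ, ← h_succ,
      ← Kernel.map_frestrictLe_trajMeasure_compProd_eq_map_trajMeasure, ih]

theorem map_trajMeasure {μ₀ : Measure (X 0)} [IsProbabilityMeasure μ₀]
    {κ : (n : ℕ) → Kernel (Π i : Finset.Iic n, X i) (X (n + 1))} [∀ n, IsMarkovKernel (κ n)]
    {η : (n : ℕ) → Kernel (Π i : Finset.Iic n, Y i) (Y (n + 1))} [∀ n, IsMarkovKernel (η n)]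
    {f : (n : ℕ) → X n → Y n} (hf : ∀ n, Measurable (f n))
    (hκ : ∀ n, (κ n).map (f (n + 1)) = (η n).comap (fun h i => f i (h i)) (by fun_prop)) :
    (Kernel.trajMeasure μ₀ κ).map (fun x n => f n (x n)) =
      Kernel.trajMeasure (μ₀.map (f 0)) η := by
  have : IsProbabilityMeasure (μ₀.map (f 0)) := Measure.isProbabilityMeasure_map (by fun_prop)
  refine eq_trajMeasure ?_ fun n => ?_
  · conv_rhs => rw [← map_eval_zero_trajMeasure μ₀ κ]
    rw [Measure.map_map (by fun_prop) (by fun_prop), Measure.map_map (by fun_prop) (by fun_prop)]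
    rfl
  · let F : (Π i : Finset.Iic n, X i) → Π i : Finset.Iic n, Y i := fun h i => f i (h i)
    have hF : Measurable F := by fun_prop
    calc ((Kernel.trajMeasure μ₀ κ).map fun x n => f n (x n)).map (frestrictLe n) ⊗ₘ η n
      _ = ((Kernel.trajMeasure μ₀ κ).map (frestrictLe n)).map F ⊗ₘ η n := by
        rw [Measure.map_map (by fun_prop) (by fun_prop), Measure.map_map hF (by fun_prop)]
        rfl
      _ = (((Kernel.trajMeasure μ₀ κ).map (frestrictLe n) ⊗ₘ κ n).map
            (Prod.map id (f (n + 1)))).map (Prod.map F id) := by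
        rw [map_left_compProd hF, ← hκ, Measure.compProd_map (hf _)]
      _ = _ := by
        rw [Kernel.map_frestrictLe_trajMeasure_compProd_eq_map_trajMeasure,
          Measure.map_map (by fun_prop) (by fun_prop), Measure.map_map (by fun_prop) (by fun_prop),
          Measure.map_map (by fun_prop) (by fun_prop)]
        rfl

end Trajectory

namespace MDP

variable {S A : Type*} [MeasurableSpace S] [MeasurableSpace A]

section Dynamics

/-- The state-action pair of a step, its reward being forgotten. -/
def stateAction (x : Step S A) : S × A := (x.1, x.2.1)

/-- The step in which `M` rewards a given state-action pair. -/
def recordReward (M : MDP S A) (x : S × A) : Step S A := (x.1, x.2, M.reward x)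

@[fun_prop]
theorem measurable_stateAction : Measurable (stateAction (S := S) (A := A)) := by
  unfold stateAction
  fun_prop

@[fun_prop]
theorem measurable_recordReward (M : MDP S A) : Measurable M.recordReward := by
  have := M.reward_measurable
  unfold recordReward
  fun_prop

/-- The law of the state-action pair at time `0`. -/
noncomputable def firstStateAction (M : MDP S A) (π : Policy S A) : Measure (S × A) :=
  M.init ⊗ₘ (π.kernel 0).comap (fun s => (fun i => i.elim0, s)) (by fun_prop)

/-- The law of the state-action pair at time `n + 1` given the steps at times `0, …, n`. -/
noncomputable def nextStateAction (M : MDP S A) (π : Policy S A) (n : ℕ) :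
    Kernel ((i : Finset.Iic n) → Step S A) (S × A) :=
  M.trans.comap (lastPair n) (measurable_lastPair n) ⊗ₖ
    (π.kernel (n + 1)).comap (Prod.map (pastSteps n) id)
      ((measurable_pastSteps n).prodMap measurable_id)

variable (M N : MDP S A) (π : Policy S A)

instance : IsProbabilityMeasure (M.firstStateAction π) := by
  unfold firstStateAction
  infer_instance

instance (n : ℕ) : IsMarkovKernel (M.nextStateAction π n) := by
  unfold nextStateAction
  infer_instance

instance : IsProbabilityMeasure (M.trajLaw π) := by
  unfold trajLaw
  infer_instance

theorem lintegral_actKernel (t : ℕ) (h : (Fin t → Step S A) × S) {f : Step S A → ℝ≥0∞}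
    (hf : Measurable f) :
    ∫⁻ x, f x ∂(M.actKernel π t h) = ∫⁻ a, f (M.recordReward (h.2, a)) ∂(π.kernel t h) := by
  have := M.reward_measurable
  rw [actKernel, Kernel.lintegral_map _ (by fun_prop) _ hf, Kernel.lintegral_id_prod (by fun_prop)]
  rfl

theorem firstStep_eq_map : M.firstStep π = (M.firstStateAction π).map M.recordReward := by
  refine Measure.ext_of_lintegral _ fun f hf => ?_
  rw [firstStep, Measure.lintegral_bind (Kernel.aemeasurable _) hf.aemeasurable,
    lintegral_map hf.lintegral_kernel (by fun_prop), lintegral_map hf (by fun_prop),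
    firstStateAction, Measure.lintegral_compProd (by fun_prop)]
  simp only [lintegral_actKernel _ _ _ _ hf, Kernel.comap_apply]

theorem nextStep_eq_map (n : ℕ) :
    M.nextStep π n = (M.nextStateAction π n).map M.recordReward := by
  refine Kernel.ext fun h => Measure.ext_of_lintegral _ fun f hf => ?_
  rw [nextStep, Kernel.lintegral_comp _ _ _ hf,
    Kernel.lintegral_deterministic_prod (measurable_pastSteps n) _ h hf.lintegral_kernel,
    Kernel.lintegral_map _ (by fun_prop) _ hf, nextStateAction,
    Kernel.lintegral_compProd _ _ _ (by fun_prop)]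
  simp only [lintegral_actKernel _ _ _ _ hf, Kernel.comap_apply]
  rfl

theorem map_stateAction_firstStep : (M.firstStep π).map stateAction = M.firstStateAction π := by
  rw [firstStep_eq_map, Measure.map_map (by fun_prop) (by fun_prop)]
  exact Measure.map_id

theorem map_stateAction_nextStep (n : ℕ) :
    (M.nextStep π n).map stateAction = M.nextStateAction π n := by
  rw [nextStep_eq_map, ← Kernel.map_comp_right _ (by fun_prop) (by fun_prop)]
  exact Kernel.map_id _

variable {M N π}

theorem firstStateAction_congr (hinit : M.init = N.init) :
    M.firstStateAction π = N.firstStateAction π := by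
  simp only [firstStateAction, hinit]

theorem nextStateAction_comap_recordReward (htrans : M.trans = N.trans)
    (hπ : π ∈ stateActionPolicies S A) (n : ℕ) :
    (N.nextStateAction π n).comap (fun h i => N.recordReward (stateAction (h i))) (by fun_prop) =
      M.nextStateAction π n := by
  obtain ⟨κ, hκ, hπκ⟩ := hπ
  ext h s hs
  simp only [Kernel.comap_apply, nextStateAction, Kernel.compProd_apply hs, hπκ, htrans]
  rfl

theorem map_recordReward_trajLaw (hinit : M.init = N.init) (htrans : M.trans = N.trans)
    (hπ : π ∈ stateActionPolicies S A) :
    (M.trajLaw π).map (fun τ t => N.recordReward (stateAction (τ t))) = N.trajLaw π := by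
  have hzero : (M.firstStep π).map (N.recordReward ∘ stateAction) = N.firstStep π := by
    rw [← Measure.map_map (by fun_prop) (by fun_prop), map_stateAction_firstStep,
      firstStateAction_congr hinit, firstStep_eq_map]
  have hsucc (n : ℕ) : (M.nextStep π n).map (N.recordReward ∘ stateAction) =
      (N.nextStep π n).comap (fun h i => N.recordReward (stateAction (h i))) (by fun_prop) := by
    rw [Kernel.map_comp_right _ (by fun_prop) (by fun_prop), map_stateAction_nextStep,
      ← nextStateAction_comap_recordReward htrans hπ, nextStep_eq_map,
      Kernel.comap_map_comm _ (by fun_prop) (by fun_prop)]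
  rw [trajLaw, trajLaw, ← hzero]
  exact map_trajMeasure (f := fun _ => N.recordReward ∘ stateAction) (fun _ => by fun_prop) hsucc

end Dynamics

section StateActionLaw

open Preorder

/-- The law of the state-action pair at time `t`. -/
noncomputable def stateActionLaw (M : MDP S A) (π : Policy S A) (t : ℕ) : Measure (S × A) :=
  (M.trajLaw π).map fun τ => stateAction (τ t)

variable (M N : MDP S A) (π : Policy S A)

instance (t : ℕ) : IsProbabilityMeasure (M.stateActionLaw π t) :=
  Measure.isProbabilityMeasure_map
    (measurable_stateAction.comp (measurable_pi_apply t)).aemeasurable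

theorem stateActionLaw_eq_map (t : ℕ) :
    M.stateActionLaw π t = ((M.trajLaw π).map fun τ => τ t).map stateAction := by
  rw [Measure.map_map (by fun_prop) (by fun_prop)]
  rfl

theorem stateActionLaw_zero : M.stateActionLaw π 0 = M.firstStateAction π := by
  rw [stateActionLaw_eq_map, trajLaw, map_eval_zero_trajMeasure, map_stateAction_firstStep]

theorem stateActionLaw_succ (n : ℕ) : M.stateActionLaw π (n + 1) =
    M.nextStateAction π n ∘ₘ (M.trajLaw π).map (frestrictLe n) := by
  rw [stateActionLaw_eq_map, trajLaw, map_eval_succ_trajMeasure,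
    Measure.map_comp _ _ (by fun_prop), map_stateAction_nextStep]

theorem map_eval_trajLaw (t : ℕ) :
    (M.trajLaw π).map (fun τ => τ t) = (M.stateActionLaw π t).map M.recordReward := by
  cases t with
  | zero => rw [stateActionLaw_zero, trajLaw, map_eval_zero_trajMeasure, firstStep_eq_map]
  | succ n =>
    rw [stateActionLaw_succ, Measure.map_comp _ _ (by fun_prop), ← nextStep_eq_map, trajLaw,
      map_eval_succ_trajMeasure]

theorem fst_stateActionLaw_zero : (M.stateActionLaw π 0).fst = M.init := by
  rw [stateActionLaw_zero, firstStateAction, Measure.fst_compProd]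

theorem fst_stateActionLaw_succ (n : ℕ) :
    (M.stateActionLaw π (n + 1)).fst = M.trans ∘ₘ M.stateActionLaw π n := by
  have hlast : M.stateActionLaw π n = ((M.trajLaw π).map (frestrictLe n)).map (lastPair n) := by
    rw [Measure.map_map (measurable_lastPair n) (by fun_prop)]
    rfl
  rw [stateActionLaw_succ, Measure.fst, Measure.map_comp _ _ measurable_fst, ← Kernel.fst_eq,
    nextStateAction, Kernel.fst_compProd, ← Kernel.comp_deterministic_eq_comap,
    ← Measure.comp_assoc, Measure.deterministic_comp_eq_map, hlast]

variable {M N π}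

theorem stateActionLaw_congr (hinit : M.init = N.init) (htrans : M.trans = N.trans)
    (hπ : π ∈ stateActionPolicies S A) (t : ℕ) : M.stateActionLaw π t = N.stateActionLaw π t := by
  rw [stateActionLaw, stateActionLaw, ← map_recordReward_trajLaw hinit htrans hπ,
    Measure.map_map (by fun_prop) (by fun_prop)]
  rfl

end StateActionLaw

end MDP

/-- The Markovian policy that draws the action from `κ` at every time. -/
def Policy.stationary {S A : Type*} [MeasurableSpace S] [MeasurableSpace A] (κ : Kernel S A)
    [IsMarkovKernel κ] : Policy S A where
  kernel _ := κ.comap Prod.snd measurable_snd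
  markov _ := inferInstance

namespace Policy

variable {S A : Type*} [MeasurableSpace S] [MeasurableSpace A]

theorem stationary_mem_markovPolicies (κ : Kernel S A) [IsMarkovKernel κ] :
    stationary κ ∈ markovPolicies S A :=
  ⟨κ, inferInstance, fun _ => rfl⟩

theorem markovPolicies_subset_stateActionPolicies :
    markovPolicies S A ⊆ stateActionPolicies S A := by
  rintro π ⟨κ, hκ, hπ⟩
  exact ⟨fun _ => κ.comap Prod.snd measurable_snd, fun _ => inferInstance, hπ⟩

theorem stateActionPolicies_nonempty [Nonempty A] : (stateActionPolicies S A).Nonempty :=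
  ⟨_, markovPolicies_subset_stateActionPolicies <| stationary_mem_markovPolicies <|
    Kernel.const S (Measure.dirac (Classical.arbitrary A))⟩

end Policy

namespace MDP

variable {S A : Type*} [MeasurableSpace S] [MeasurableSpace A]

section Occupation

/-- The unnormalized discounted occupation measure of the state-action pairs, of total mass
`(1 - γ)⁻¹`: it gives a set `B` the expected discounted number of visits to `B`. -/
noncomputable def occupation (M : MDP S A) (π : Policy S A) : Measure (S × A) :=
  Measure.sum fun t => ENNReal.ofReal M.discount ^ t • M.stateActionLaw π t

variable (M N : MDP S A) (π : Policy S A)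

theorem occupation_univ : M.occupation π Set.univ = (1 - ENNReal.ofReal M.discount)⁻¹ := by
  simp [occupation, ENNReal.tsum_geometric]

theorem ofReal_discount_lt_one : ENNReal.ofReal M.discount < 1 :=
  ENNReal.ofReal_lt_one.2 M.discount_lt_one

instance : IsFiniteMeasure (M.occupation π) := by
  refine ⟨?_⟩
  rw [occupation_univ, ENNReal.inv_lt_top, tsub_pos_iff_lt]
  exact M.ofReal_discount_lt_one

theorem occupation_real_univ : (M.occupation π).real Set.univ = (1 - M.discount)⁻¹ := by
  rw [measureReal_def, occupation_univ, ENNReal.toReal_inv,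
    ENNReal.toReal_sub_of_le M.ofReal_discount_lt_one.le ENNReal.one_ne_top,
    ENNReal.toReal_ofReal M.discount_pos.le, ENNReal.toReal_one]

theorem fst_occupation_eq_sum : (M.occupation π).fst =
    Measure.sum fun t => ENNReal.ofReal M.discount ^ t • (M.stateActionLaw π t).fst := by
  rw [occupation, Measure.fst_sum]
  congr with t : 1
  exact Measure.map_smul _ _ _

theorem fst_occupation : (M.occupation π).fst =
    M.init + ENNReal.ofReal M.discount • (M.trans ∘ₘ M.occupation π) := by
  have hbind : M.trans ∘ₘ M.occupation π = Measure.sum fun t =>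
      ENNReal.ofReal M.discount ^ t • (M.trans ∘ₘ M.stateActionLaw π t) := by
    rw [occupation, Measure.bind_sum _ _ (Kernel.aemeasurable _)]
    simp only [Measure.comp_smul]
  ext s hs
  rw [fst_occupation_eq_sum, Measure.sum_apply _ hs, tsum_eq_zero_add' ENNReal.summable,
    Measure.add_apply, hbind]
  simp only [fst_stateActionLaw_zero, fst_stateActionLaw_succ, Measure.smul_apply,
    Measure.sum_apply _ hs, smul_eq_mul, pow_zero, one_mul, pow_succ', mul_assoc,
    ENNReal.tsum_mul_left]

theorem stateActionLaw_stationary (κ : Kernel S A) [IsMarkovKernel κ] (t : ℕ) :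
    M.stateActionLaw (.stationary κ) t = (M.stateActionLaw (.stationary κ) t).fst ⊗ₘ κ := by
  cases t with
  | zero =>
    rw [fst_stateActionLaw_zero, stateActionLaw_zero]
    rfl
  | succ n =>
    have hnext : M.nextStateAction (.stationary κ) n =
        (Kernel.id ×ₖ κ) ∘ₖ M.trans.comap (lastPair n) (measurable_lastPair n) := by
      rw [← Kernel.compProd_prodMkLeft_eq_comp]
      rfl
    have hfst : (M.nextStateAction (.stationary κ) n).fst =
        M.trans.comap (lastPair n) (measurable_lastPair n) := by
      rw [nextStateAction, Kernel.fst_compProd]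
    rw [stateActionLaw_succ, Measure.fst, Measure.map_comp _ _ measurable_fst, ← Kernel.fst_eq,
      hfst, hnext, Measure.compProd_eq_comp_prod, Measure.comp_assoc]

theorem occupation_stationary (κ : Kernel S A) [IsMarkovKernel κ] :
    M.occupation (.stationary κ) = (M.occupation (.stationary κ)).fst ⊗ₘ κ := by
  rw [fst_occupation_eq_sum, Measure.compProd_sum_left, occupation]
  congr with t : 1
  rw [Measure.compProd_smul_left, ← stateActionLaw_stationary]

theorem fst_occupation_eq_of_compProd {κ : Kernel S A} [IsMarkovKernel κ]
    (h : M.occupation π = (M.occupation π).fst ⊗ₘ κ) : (M.occupation π).fst =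
      M.init + ENNReal.ofReal M.discount •
        ((M.trans ∘ₖ (Kernel.id ×ₖ κ)) ∘ₘ (M.occupation π).fst) := by
  rw [← Measure.comp_assoc, ← Measure.compProd_eq_comp_prod, ← h, ← fst_occupation]

variable {M N π}

theorem occupation_congr (hinit : M.init = N.init) (htrans : M.trans = N.trans)
    (hdisc : M.discount = N.discount) (hπ : π ∈ stateActionPolicies S A) :
    M.occupation π = N.occupation π := by
  simp only [occupation, hdisc, stateActionLaw_congr hinit htrans hπ]

theorem occupation_stationary_eq {κ : Kernel S A} [IsMarkovKernel κ]
    (h : M.occupation π = (M.occupation π).fst ⊗ₘ κ) :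
    M.occupation (.stationary κ) = M.occupation π := by
  have hfst : (M.occupation (.stationary κ)).fst = (M.occupation π).fst :=
    eq_of_eq_add_smul_comp M.ofReal_discount_lt_one
      (fst_occupation_eq_of_compProd _ _ (M.occupation_stationary κ))
      (fst_occupation_eq_of_compProd _ _ h)
  rw [occupation_stationary, hfst, ← h]

variable (M π) in
theorem exists_markovPolicies_occupation_eq [StandardBorelSpace A] [Nonempty A] :
    ∃ π' ∈ markovPolicies S A, M.occupation π' = M.occupation π :=
  ⟨.stationary (M.occupation π).condKernel, Policy.stationary_mem_markovPolicies _,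
    occupation_stationary_eq ((M.occupation π).disintegrate _).symm⟩

end Occupation

section Value

variable {M : MDP S A} {π : Policy S A}

theorem integral_comp_eval (t : ℕ) {f : Step S A → ℝ} (hf : Measurable f) :
    ∫ τ, f (τ t) ∂(M.trajLaw π) = ∫ x, f (M.recordReward x) ∂(M.stateActionLaw π t) := by
  rw [← integral_map (φ := M.recordReward) (by fun_prop) hf.aestronglyMeasurable,
    ← map_eval_trajLaw, integral_map (measurable_pi_apply t).aemeasurable hf.aestronglyMeasurable]

theorem hasSum_integral_occupation {f : S × A → ℝ} (hf : Integrable f (M.occupation π)) :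
    HasSum (fun t => M.discount ^ t * ∫ x, f x ∂(M.stateActionLaw π t))
      (∫ x, f x ∂(M.occupation π)) := by
  have hsum := hasSum_integral_measure hf
  simp only [integral_smul_measure, ENNReal.toReal_pow, ENNReal.toReal_ofReal M.discount_pos.le,
    smul_eq_mul] at hsum
  exact hsum

theorem integrable_stateActionLaw {f : S × A → ℝ} (hf : Integrable f (M.occupation π)) (t : ℕ) :
    Integrable f (M.stateActionLaw π t) := by
  have hsmul := hf.mono_measure (Measure.le_sum _ t)
  rwa [integrable_smul_measure] at hsmul
  · exact pow_ne_zero _ (ENNReal.ofReal_pos.2 M.discount_pos).ne'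
  · exact ENNReal.pow_ne_top ENNReal.ofReal_ne_top

theorem integrable_reward_eval (h : Integrable M.reward (M.occupation π)) (t : ℕ) :
    Integrable (fun τ => (τ t).2.2) (M.trajLaw π) := by
  have hmeas : Measurable fun x : Step S A => x.2.2 := by fun_prop
  have hlaw : Integrable (fun x : Step S A => x.2.2) ((M.trajLaw π).map fun τ => τ t) := by
    rw [map_eval_trajLaw, integrable_map_measure hmeas.aestronglyMeasurable (by fun_prop)]
    exact integrable_stateActionLaw h t
  exact hlaw.comp_measurable (by fun_prop)

theorem value_eq_integral_occupation (h : Integrable M.reward (M.occupation π)) :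
    M.value π = ∫ x, M.reward x ∂(M.occupation π) := by
  have hint (t : ℕ) : Integrable (fun τ => M.discount ^ t * (τ t).2.2) (M.trajLaw π) :=
    (integrable_reward_eval h t).const_mul _
  have hnorm (t : ℕ) : ∫ τ, ‖M.discount ^ t * (τ t).2.2‖ ∂(M.trajLaw π) =
      M.discount ^ t * ∫ x, ‖M.reward x‖ ∂(M.stateActionLaw π t) := by
    simp only [norm_mul, norm_pow, Real.norm_of_nonneg M.discount_pos.le, integral_const_mul]
    rw [integral_comp_eval t (f := fun x => ‖x.2.2‖) (by fun_prop)]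
    rfl
  rw [value, ← integral_tsum_of_summable_integral_norm hint,
    ← (hasSum_integral_occupation h).tsum_eq]
  · refine tsum_congr fun t => ?_
    rw [integral_const_mul, integral_comp_eval t (f := fun x => x.2.2) (by fun_prop)]
    rfl
  · simpa only [hnorm] using (hasSum_integral_occupation h.norm).summable

theorem abs_value_le {C : ℝ} (hC : ∀ x, |M.reward x| ≤ C) (π : Policy S A) :
    |M.value π| ≤ C * (1 - M.discount)⁻¹ := by
  have hint : Integrable M.reward (M.occupation π) :=
    .of_bound M.reward_measurable.aestronglyMeasurable C (.of_forall hC)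
  rw [value_eq_integral_occupation hint, ← M.occupation_real_univ π]
  exact norm_integral_le_of_norm_le_const (f := M.reward) (.of_forall hC)

theorem value_le_optValue {C : ℝ} (hC : ∀ x, |M.reward x| ≤ C) (π : Policy S A) :
    M.value π ≤ M.optValue :=
  le_ciSup (f := M.value) ⟨_, Set.forall_mem_range.2 fun π' => le_of_abs_le (abs_value_le hC π')⟩ π

theorem optValue_le [Nonempty (Policy S A)] {C : ℝ} (hC : ∀ x, |M.reward x| ≤ C) :
    M.optValue ≤ C * (1 - M.discount)⁻¹ :=
  ciSup_le fun π => le_of_abs_le (abs_value_le hC π)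

end Value

end MDP

theorem integral_le_lowerExpectation {Θ : Type*} [MeasurableSpace Θ] {μ : Measure Θ}
    {f g h : Θ → ℝ} (hg : Integrable g μ) (hh : Integrable h μ) (hgf : ∀ θ, g θ ≤ f θ)
    (hfh : ∀ θ, f θ ≤ h θ) : ∫ θ, g θ ∂μ ≤ lowerExpectation μ f := by
  refine le_csSup ⟨∫ θ, h θ ∂μ, ?_⟩ ⟨g, hg, hgf, rfl⟩
  rintro _ ⟨g', hg', hle, rfl⟩
  exact integral_mono hg' hh fun θ => (hle θ).trans (hfh θ)

namespace TaskDistribution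

variable {S A Θ : Type*} [MeasurableSpace S] [MeasurableSpace A] [MeasurableSpace Θ]
  {D : TaskDistribution S A Θ} {π : Policy S A}

theorem value_task_ae_eq (hπ : π ∈ stateActionPolicies S A)
    (hint : Integrable (Function.uncurry D.reward) (D.law.prod (D.average.occupation π))) :
    (fun θ => (D.task θ).value π) =ᵐ[D.law]
      fun θ => ∫ x, D.reward θ x ∂(D.average.occupation π) := by
  filter_upwards [hint.prod_right_ae] with θ hθ
  have hocc : (D.task θ).occupation π = D.average.occupation π :=
    MDP.occupation_congr rfl rfl rfl hπ
  rw [← hocc] at hθ ⊢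
  exact MDP.value_eq_integral_occupation hθ

theorem integrable_value (hπ : π ∈ stateActionPolicies S A)
    (hint : Integrable (Function.uncurry D.reward) (D.law.prod (D.average.occupation π))) :
    Integrable (fun θ => (D.task θ).value π) D.law :=
  (integrable_congr (value_task_ae_eq hπ hint)).2 hint.integral_prod_left

theorem meanValue_eq_value_average (hπ : π ∈ stateActionPolicies S A)
    (hint : Integrable (Function.uncurry D.reward) (D.law.prod (D.average.occupation π))) :
    D.meanValue π = D.average.value π := by
  calc D.meanValue π = ∫ θ, ∫ x, D.reward θ x ∂(D.average.occupation π) ∂D.law :=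
        integral_congr_ae (value_task_ae_eq hπ hint)
    _ = ∫ x, D.average.reward x ∂(D.average.occupation π) := integral_integral_swap hint
    _ = D.average.value π :=
        (MDP.value_eq_integral_occupation hint.integral_prod_right).symm

theorem image_meanValue_markovPolicies [StandardBorelSpace A] [Nonempty A]
    (hint : ∀ π ∈ stateActionPolicies S A,
      Integrable (Function.uncurry D.reward) (D.law.prod (D.average.occupation π))) :
    D.meanValue '' markovPolicies S A = D.meanValue '' stateActionPolicies S A := by
  have hsub := Policy.markovPolicies_subset_stateActionPolicies (S := S) (A := A)
  refine (Set.image_mono hsub).antisymm ?_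
  rintro _ ⟨π, hπ, rfl⟩
  obtain ⟨π', hπ', hocc⟩ := D.average.exists_markovPolicies_occupation_eq π
  refine ⟨π', hπ', ?_⟩
  rw [meanValue_eq_value_average (hsub hπ') (hint π' (hsub hπ')),
    meanValue_eq_value_average hπ (hint π hπ),
    MDP.value_eq_integral_occupation (hint π hπ).integral_prod_right,
    MDP.value_eq_integral_occupation (hint π' (hsub hπ')).integral_prod_right, hocc]

variable {C : Θ → ℝ}

theorem integrable_uncurry_reward (hC : Integrable C D.law) (hb : ∀ θ x, |D.reward θ x| ≤ C θ)
    (ν : Measure (S × A)) [IsFiniteMeasure ν] :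
    Integrable (Function.uncurry D.reward) (D.law.prod ν) :=
  (hC.comp_fst ν).mono' D.reward_measurable.aestronglyMeasurable (.of_forall fun p => hb p.1 p.2)

theorem meanValue_le_optimalReturn (hC : Integrable C D.law) (hb : ∀ θ x, |D.reward θ x| ≤ C θ)
    (hπ : Integrable (fun θ => (D.task θ).value π) D.law) : D.meanValue π ≤ D.optimalReturn :=
  have : Nonempty (Policy S A) := ⟨π⟩
  integral_le_lowerExpectation hπ (hC.mul_const (1 - D.discount)⁻¹)
    (fun θ => MDP.value_le_optValue (M := D.task θ) (hb θ) π)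
    fun θ => MDP.optValue_le (M := D.task θ) (hb θ)

end TaskDistribution

theorem theorem2 {S A Θ : Type*} [MeasurableSpace S] [MeasurableSpace A] [MeasurableSpace Θ]
    [StandardBorelSpace A] [Nonempty A] (D : TaskDistribution S A Θ)
    (hbound : ∃ C : Θ → ℝ, Integrable C D.law ∧ ∀ θ x, |D.reward θ x| ≤ C θ) :
    (∀ π ∈ stateActionPolicies S A,
      Integrable (fun θ => (D.task θ).value π) D.law ∧
        ∫ θ, (D.task θ).value π ∂D.law = D.average.value π) ∧
    D.bestValue (markovPolicies S A) = D.bestValue (stateActionPolicies S A) ∧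
    (∀ v : ℝ, IsGreatest (D.meanValue '' markovPolicies S A) v ↔
      IsGreatest (D.meanValue '' stateActionPolicies S A) v) ∧
    D.bestValue (stateActionPolicies S A) ≤ D.optimalReturn := by
  obtain ⟨C, hC, hb⟩ := hbound
  have hint (π : Policy S A) :
      Integrable (Function.uncurry D.reward) (D.law.prod (D.average.occupation π)) :=
    TaskDistribution.integrable_uncurry_reward hC hb _
  have himage : D.meanValue '' markovPolicies S A = D.meanValue '' stateActionPolicies S A :=
    TaskDistribution.image_meanValue_markovPolicies fun π _ => hint π
  refine ⟨fun π hπ => ⟨TaskDistribution.integrable_value hπ (hint π),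
    TaskDistribution.meanValue_eq_value_average hπ (hint π)⟩, congrArg sSup himage,
    fun v => by rw [himage], ?_⟩
  refine csSup_le (Policy.stateActionPolicies_nonempty.image _) ?_
  rintro _ ⟨π, hπ, rfl⟩
  exact TaskDistribution.meanValue_le_optimalReturn hC hb
    (TaskDistribution.integrable_value hπ (hint π))
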